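/- Let $D=D_1\cup\dots\cup D_n$ be an oriented virtual link diagram with $n$ numbered unicursal components, i.e. a plane 4-valent graph whose vertices are classical crossings (with over/under information) and virtual crossings. For a classical crossing $c$ let $\operatorname{sign}(c)=\pm1$ be its usual sign ($+1$ if the direction of the overpass followed by the direction of the underpass is a positively oriented frame of the plane). Put $$\mathrm{lk}^o_D(D_i)=\sum_{c:\ D_i\text{ is overcrossing}}\operatorname{sign}(c),\qquad \mathrm{lk}^u_D(D_i)=\sum_{c:\ D_i\text{ is undercrossing}}\operatorname{sign}(c),\qquad w_D(D_i)=\mathrm{lk}^o_D(D_i)-\mathrm{lk}^u_D(D_i),$$ where the sums run over classical crossings ($w_D(D_i)$ is the wriggle number of $D_i$). Let $\tilde D$ be the covering graph of $D$: its vertices are the classical crossings and its edges are the long arcs, which run along $D$ between consecutive classical crossings and ignore the virtual crossings (a component without classical crossings is a closed edge without vertices). The virtual index cocycle $vi_D\in C^1(\tilde D,\mathbb Z)$ assigns to a long arc $e$ the sum over the passages of $e$ through virtual crossings of $+1$ if the other branch crosses $e$ from right to left and $-1$ if it crosses $e$ from left to right. Let $\iota_D=[vi_D]\in H^1(\tilde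 D,\mathbb Z)$ be the virtual index class, and regard $D_i$ as a cycle in $\tilde D$. For components $D_i,D_j$ let $w(D_i,D_j)=w_{D_i\cup D_j}(D_i)$ be the wriggle number of $D_i$ in the diagram $D_i\cup D_j$ obtained by erasing the other components. Then for every oriented virtual link diagram $D=D_1\cup\dots\cup D_n$ and all $i,j\in\{1,\dots,n\}$: 1. $w_D(D_i)=-\iota_D(D_i)$; 2. $w(D_i,D_j)=-\iota_{D_i\cup D_j}(D_i)$; 3. $w(D_i,D_j)$ is an invariant of oriented virtual links with numbered components: it takes the same value on any two diagrams related by a finite sequence of classical Reidemeister moves $R_1,R_2,R_3$ and virtual moves $VR_1,VR_2,VR_3,SVR_3$ that respects the numbering; 4. $w(D_j,D_i)=-w(D_i,D_j)$; 5. $w_D(D_i)=\sum_{j=1}^n w(D_i,D_j)$. -/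

import Mathlib

open scoped BigOperators

namespace VirtualLink

/-- The types of the double points of an oriented virtual link diagram: a classical crossing of
sign `+1`, a classical crossing of sign `-1`, or a virtual crossing. -/
inductive CrossingType : Type
  | positive
  | negative
  | virtual

/-- The sign of a classical crossing (the value on virtual crossings is never used). -/
def CrossingType.sign : CrossingType → ℤ
  | .positive => 1
  | .negative => -1
  | .virtual => 0

/-- Exchange of the two classical types; virtual stays virtual. -/
def CrossingType.opposite : CrossingType → CrossingType
  | .positive => .negative
  | .negative => .positive
  | .virtual => .virtual

/-- An oriented link diagram with classical and virtual crossings, given by its oriented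
4-valent ribbon graph, whose unicursal components are numbered by `I`.

Travelling along the components one passes through *passages*. Every crossing `x` has the two
passages `strand (x, true)` and `strand (x, false)`, labelled so that the pair of directions
(direction of `strand (x, true)`, direction of `strand (x, false)`) is a positively oriented
frame; in other words `strand (x, false)` crosses `strand (x, true)` from right to left. All the
other passages are 2-valent subdivision points of the curves (so that a circle without crossings is
a component with a single point, say). The passage met after `a` is `next a`. -/
structure Diagram (I : Type) where
  Passage : Type
  Crossing : Type
  [fintypePassage : Fintype Passage]
  [fintypeCrossing : Fintype Crossing]
  next : Equiv.Perm Passage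
  strand : Crossing × Bool ↪ Passage
  kind : Crossing → CrossingType
  comp : Passage → I
  comp_surjective : Function.Surjective comp
  comp_eq_iff : ∀ a b, comp a = comp b ↔ next.SameCycle a b

attribute [instance] Diagram.fintypePassage Diagram.fintypeCrossing

namespace Diagram

variable {I : Type} (D : Diagram I)

/-! ### Planarity

The edge of the ribbon graph that leaves the passage `a` (and arrives at `next a`) is denoted by
`a` too. Its left side is `(a, true)` and its right side is `(a, false)`. -/

/-- Two sides of edges that meet in a corner at a vertex. At a crossing, think of `strand (x, true)`
as heading east and of `strand (x, false)` as heading north; the edge arriving at a passage `a` is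
the one that leaves `next⁻¹ a`. -/
inductive Corner : D.Passage × Bool → D.Passage × Bool → Prop
  | northEast (x : D.Crossing) :
      Corner (D.strand (x, true), true) (D.strand (x, false), false)
  | northWest (x : D.Crossing) :
      Corner (D.next.symm (D.strand (x, true)), true) (D.strand (x, false), true)
  | southWest (x : D.Crossing) :
      Corner (D.next.symm (D.strand (x, true)), false) (D.next.symm (D.strand (x, false)), true)
  | southEast (x : D.Crossing) :
      Corner (D.strand (x, true), false) (D.next.symm (D.strand (x, false)), false)
  | point (a : D.Passage) (ha : a ∉ Set.range D.strand) (side : Bool) :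
      Corner (D.next.symm a, side) (a, side)

/-- The faces of the ribbon graph: the boundary circles of the ribbon surface, each of which
bounds a disc in the closed oriented surface of the diagram. -/
def Face : Type := Quot D.Corner

/-- Adjacency in the 4-valent graph. -/
inductive Linked : D.Passage → D.Passage → Prop
  | along (a : D.Passage) : Linked a (D.next a)
  | across (x : D.Crossing) : Linked (D.strand (x, true)) (D.strand (x, false))

/-- The connected pieces of the 4-valent graph. -/
def Piece : Type := Quot D.Linked

/-- The diagram is a plane diagram: every connected piece of its ribbon graph has genus zero, that
is, the Euler characteristic `V - E + F` is twice the number of pieces. -/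
def IsPlane : Prop :=
  ((Nat.card D.Crossing + Nat.card {a : D.Passage // a ∉ Set.range D.strand} : ℕ) : ℤ)
    - (Nat.card D.Passage : ℤ) + (Nat.card D.Face : ℤ) = 2 * (Nat.card D.Piece : ℤ)

/-! ### Classical crossings and wriggle numbers -/

/-- The crossing is classical. -/
def IsClassical (x : D.Crossing) : Prop := D.kind x ≠ .virtual

/-- The overcrossing passage at a classical crossing: a classical crossing is positive if and
only if (direction of the overpass, direction of the underpass) is a positive frame. -/
def overPass (x : D.Crossing) : D.Passage :=
  match D.kind x with
  | .negative => D.strand (x, false)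
  | _ => D.strand (x, true)

/-- The undercrossing passage at a classical crossing. -/
def underPass (x : D.Crossing) : D.Passage :=
  match D.kind x with
  | .negative => D.strand (x, true)
  | _ => D.strand (x, false)

open Classical in
/-- The over linking number of the component `i`. -/
noncomputable def overLinking (i : I) : ℤ :=
  ∑ x with D.IsClassical x ∧ D.comp (D.overPass x) = i, (D.kind x).sign

open Classical in
/-- The under linking number of the component `i`. -/
noncomputable def underLinking (i : I) : ℤ :=
  ∑ x with D.IsClassical x ∧ D.comp (D.underPass x) = i, (D.kind x).sign

/-- The wriggle number of the component `i`. -/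
noncomputable def wriggle (i : I) : ℤ := D.overLinking i - D.underLinking i

/-! ### The covering graph, the virtual index cocycle and the index class -/

/-- The two edges meeting at the passage `b` belong to the same long arc when `b` is not a passage
through a classical crossing. -/
def ArcStep (a b : D.Passage) : Prop :=
  b = D.next a ∧ ∀ x s, D.IsClassical x → D.strand (x, s) ≠ b

/-- The long arcs of the diagram, which are the edges of the covering graph (a component without
classical crossings gives one closed long arc, without end points). -/
def LongArc : Type := Quot D.ArcStep

/-- The long arc that contains the edge leaving the passage `a`. If `a` is not a passage through
a classical crossing, this is the long arc on which `a` lies. -/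
def arc (a : D.Passage) : D.LongArc := Quot.mk _ a

noncomputable instance : Fintype D.LongArc :=
  haveI : Finite D.LongArc := inferInstanceAs (Finite (Quot D.ArcStep))
  Fintype.ofFinite _

/-- The vertices of the covering graph. -/
abbrev Vertex : Type := {x : D.Crossing // D.IsClassical x}

noncomputable instance : Fintype D.Vertex := Fintype.ofFinite _

open Classical in
/-- The number of ends of the long arc `e` arriving at `v` minus the number of ends leaving `v`. -/
noncomputable def incidence (e : D.LongArc) (v : D.Vertex) : ℤ :=
  ∑ s : Bool, ((if D.arc (D.next.symm (D.strand (v.1, s))) = e then 1 else 0)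
    - (if D.arc (D.strand (v.1, s)) = e then 1 else 0))

/-- The coboundary `C⁰ → C¹` of the covering graph, with integer coefficients. -/
noncomputable def coboundary : (D.Vertex → ℤ) →ₗ[ℤ] (D.LongArc → ℤ) where
  toFun f e := ∑ v, D.incidence e v * f v
  map_add' f g := by
    funext e
    simp [mul_add, Finset.sum_add_distrib]
  map_smul' c f := by
    funext e
    simp [Finset.mul_sum, mul_left_comm]

/-- The boundary `C₁ → C₀` of the covering graph, with integer coefficients. -/
noncomputable def boundary : (D.LongArc → ℤ) →ₗ[ℤ] (D.Vertex → ℤ) where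
  toFun z v := ∑ e, D.incidence e v * z e
  map_add' f g := by
    funext e
    simp [mul_add, Finset.sum_add_distrib]
  map_smul' c f := by
    funext e
    simp [Finset.mul_sum, mul_left_comm]

/-- The first cohomology group of the covering graph (every 1-cochain of a graph is a cocycle). -/
abbrev H1 : Type := (D.LongArc → ℤ) ⧸ LinearMap.range D.coboundary

/-- The integral 1-cycles of the covering graph. -/
abbrev Cycle : Type := LinearMap.ker D.boundary

/-- The value of a cohomology class on a cycle. -/
noncomputable def eval (z : D.Cycle) : D.H1 →ₗ[ℤ] ℤ :=
  Submodule.liftQ _ (∑ e : D.LongArc, z.1 e • LinearMap.proj (R := ℤ) (φ := fun _ => ℤ) e) (by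
    rintro _ ⟨f, rfl⟩
    have hz : ∀ v, ∑ e, D.incidence e v * z.1 e = 0 := fun v => congrFun z.2 v
    simp only [LinearMap.mem_ker, LinearMap.sum_apply, LinearMap.smul_apply,
      LinearMap.proj_apply, smul_eq_mul]
    show ∑ e, z.1 e * ∑ v, D.incidence e v * f v = 0
    simp only [Finset.mul_sum]
    rw [Finset.sum_comm]
    refine Finset.sum_eq_zero fun v _ => ?_
    calc ∑ e, z.1 e * (D.incidence e v * f v)
        = (∑ e, D.incidence e v * z.1 e) * f v := by
          rw [Finset.sum_mul]
          exact Finset.sum_congr rfl fun e _ => by ring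
      _ = 0 := by rw [hz v, zero_mul])

open Classical in
/-- The virtual index cocycle: the sum, over the virtual crossings lying on the long arc `e`, of
the signs `+1` when the other branch crosses `e` from right to left and `-1` when it crosses `e`
from left to right. -/
noncomputable def virtualIndex (e : D.LongArc) : ℤ :=
  ∑ x with D.kind x = .virtual, ((if D.arc (D.strand (x, true)) = e then 1 else 0)
    - (if D.arc (D.strand (x, false)) = e then 1 else 0))

/-- The virtual index class `ι_D`. -/
noncomputable def indexClass : D.H1 := Submodule.Quotient.mk D.virtualIndex

theorem comp_next (a : D.Passage) : D.comp (D.next a) = D.comp a :=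
  ((D.comp_eq_iff a (D.next a)).2 ⟨1, by simp⟩).symm

theorem comp_next_symm (a : D.Passage) : D.comp (D.next.symm a) = D.comp a := by
  have h := D.comp_next (D.next.symm a)
  rw [Equiv.apply_symm_apply] at h
  exact h.symm

/-- The component to which a long arc belongs. -/
def arcComp : D.LongArc → I :=
  Quot.lift D.comp (by
    rintro a b ⟨rfl, -⟩
    exact (D.comp_next a).symm)

open Classical in
/-- The cycle of the covering graph formed by the unicursal component `i`. -/
noncomputable def componentCycle (i : I) : D.Cycle :=
  ⟨fun e => if D.arcComp e = i then 1 else 0, by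
    rw [LinearMap.mem_ker]
    funext v
    show ∑ e, D.incidence e v * (if D.arcComp e = i then 1 else 0) = 0
    simp only [incidence, Finset.sum_mul]
    rw [Finset.sum_comm]
    refine Finset.sum_eq_zero fun s _ => ?_
    simp only [sub_mul, ite_mul, one_mul, zero_mul, Finset.sum_sub_distrib, Finset.sum_ite_eq,
      Finset.mem_univ, if_true]
    have h : D.arcComp (D.arc (D.next.symm (D.strand (v.1, s))))
        = D.arcComp (D.arc (D.strand (v.1, s))) := D.comp_next_symm _
    rw [h, sub_self]⟩

/-! ### Sublinks and pairwise wriggle numbers -/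

open Classical in
/-- The subdiagram formed by the components in `S`: the others are erased, and their crossings with
the remaining components become simple points of the latter. -/
noncomputable def sub (S : Set I) : Diagram S where
  Passage := {a : D.Passage // D.comp a ∈ S}
  Crossing := {x : D.Crossing // ∀ s, D.comp (D.strand (x, s)) ∈ S}
  next := D.next.subtypePerm fun a => by rw [D.comp_next]
  strand := ⟨fun y => ⟨D.strand (y.1.1, y.2), y.1.2 y.2⟩, by
    rintro ⟨⟨x, hx⟩, s⟩ ⟨⟨x', hx'⟩, s'⟩ h
    have h' := D.strand.injective (Subtype.ext_iff.1 h)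
    simp only [Prod.mk.injEq] at h'
    obtain ⟨rfl, rfl⟩ := h'
    rfl⟩
  kind x := D.kind x.1
  comp a := ⟨D.comp a.1, a.2⟩
  comp_surjective := by
    rintro ⟨i, hi⟩
    obtain ⟨a, rfl⟩ := D.comp_surjective i
    exact ⟨⟨a, hi⟩, rfl⟩
  comp_eq_iff a b := by
    rw [Equiv.Perm.sameCycle_subtypePerm, ← D.comp_eq_iff, Subtype.mk.injEq]

/-- The diagram `D_i ∪ D_j`. -/
noncomputable abbrev pair (i j : I) : Diagram ({i, j} : Set I) := D.sub {i, j}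

/-- The component `i` as a component of `D_i ∪ D_j`. -/
abbrev inPair (i j : I) : ({i, j} : Set I) := ⟨i, Set.mem_insert i {j}⟩

/-- The wriggle number `w(D_i, D_j)` of two components: the wriggle number of the component `D_i`
of `D_i ∪ D_j`. -/
noncomputable def pairWriggle (i j : I) : ℤ := (D.pair i j).wriggle (inPair i j)

end Diagram

/-! ### Reidemeister moves

A move replaces a piece of a diagram inside a disc, a tangle, by another one. -/

/-- A tangle: `k` oriented strands, the `j`-th of which runs through `len j + 1` passages, with
crossings as in a diagram. -/
structure Tangle (k : ℕ) where
  len : Fin k → ℕ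
  Crossing : Type
  strand : Crossing × Bool ↪ (Σ j : Fin k, Fin (len j + 1))
  kind : Crossing → CrossingType

/-- The passages of a tangle: `⟨j, m⟩` is the `m`-th passage of the `j`-th strand. -/
abbrev Tangle.Passage {k : ℕ} (T : Tangle k) : Type := Σ j : Fin k, Fin (T.len j + 1)

/-- The outer part of a diagram, in which `k` oriented strands are left to be filled in. Here
`next` describes the order in which the outer passages and the missing strands are met. -/
structure Context (k : ℕ) (I : Type) where
  Passage : Type
  Crossing : Type
  next : Equiv.Perm (Passage ⊕ Fin k)
  strand : Crossing × Bool ↪ Passage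
  kind : Crossing → CrossingType
  comp : Passage ⊕ Fin k → I

/-- A missing strand is entered at its first passage. -/
def Tangle.enter {k : ℕ} (T : Tangle k) {A : Type} : A ⊕ Fin k → A ⊕ T.Passage
  | .inl a => .inl a
  | .inr j => .inr ⟨j, 0⟩

/-- The diagram `D` is (isomorphic to) the result of filling the tangle `T` into `C`. -/
structure Filling {k : ℕ} {I : Type} (C : Context k I) (T : Tangle k) (D : Diagram I) where
  passage : C.Passage ⊕ T.Passage ≃ D.Passage
  crossing : C.Crossing ⊕ T.Crossing ≃ D.Crossing
  strand_outer : ∀ x s, D.strand (crossing (.inl x), s) = passage (.inl (C.strand (x, s)))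
  strand_inner : ∀ x s, D.strand (crossing (.inr x), s) = passage (.inr (T.strand (x, s)))
  kind_outer : ∀ x, D.kind (crossing (.inl x)) = C.kind x
  kind_inner : ∀ x, D.kind (crossing (.inr x)) = T.kind x
  comp_outer : ∀ a, D.comp (passage (.inl a)) = C.comp (.inl a)
  comp_inner : ∀ j m, D.comp (passage (.inr ⟨j, m⟩)) = C.comp (.inr j)
  next_outer : ∀ a, D.next (passage (.inl a)) = passage (T.enter (C.next (.inl a)))
  next_inner : ∀ j (m : Fin (T.len j)),
    D.next (passage (.inr ⟨j, m.castSucc⟩)) = passage (.inr ⟨j, m.succ⟩)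
  next_last : ∀ j,
    D.next (passage (.inr ⟨j, Fin.last (T.len j)⟩)) = passage (T.enter (C.next (.inr j)))

/-- `k` strands without crossings, with `m + 1` subdivision points on each of them. -/
def plainTangle (k m : ℕ) : Tangle k where
  len _ := m
  Crossing := Empty
  strand := ⟨fun y => y.1.elim, fun y => y.1.elim⟩
  kind x := x.elim

/-- A strand with one kink, whose first passage through the crossing is the one labelled `b`. -/
def kink (c : CrossingType) (b : Bool) : Tangle 1 where
  len _ := 1
  Crossing := Unit
  strand := ⟨fun y => ⟨0, if y.2 = b then 0 else 1⟩, by revert b; decide⟩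
  kind _ := c

/-- The strand of the bigon (`true` for the strand `1`) to which a passage belongs, and its position
on this strand. The strand `0` runs through the crossing `0` (`false`) and then through the
crossing `1` (`true`); the strand `1` runs in the same order if `parallel` holds, and in the opposite
order otherwise. The strand `0` carries the label `b` at the crossing `0` and `!b` at the crossing
`1`. -/
def bigonStrand (b parallel : Bool) (y : Bool × Bool) : Σ _ : Fin 2, Fin (1 + 1) :=
  if y.2 = xor b y.1 then ⟨0, if y.1 then 1 else 0⟩
  else ⟨1, if y.1 = parallel then 1 else 0⟩

/-- Two strands which cross twice and form a bigon. The crossings have opposite signs, so that in the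
classical case one strand is over the other one at both of them; or both of them are virtual. -/
def bigon (c : CrossingType) (b parallel : Bool) : Tangle 2 where
  len _ := 1
  Crossing := Bool
  strand := ⟨bigonStrand b parallel, by revert b parallel; decide⟩
  kind x := if x then c.opposite else c

/-- Three strands `0, 1, 2` cross pairwise and form a triangle with vertices `0, 1, 2`, where the
vertex `i` is the crossing of the strands `i + 1` and `i + 2` (modulo 3). Let `o l` say that the
strand `l` runs from the vertex `l + 1` to the vertex `l + 2`, and let `t` say that the triangle
`0, 1, 2` is oriented counterclockwise. Then (strand `i + 1`, strand `i + 2`) is a positive frame if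
and only if the following holds. -/
def triangleFrame (t : Bool) (o : Fin 3 → Bool) (i : Fin 3) : Bool :=
  t == (o (i + 1) == o (i + 2))

/-- The passages of a triangle tangle. -/
def triangleStrand (t : Bool) (o : Fin 3 → Bool) (y : Fin 3 × Bool) : Σ _ : Fin 3, Fin (1 + 1) :=
  if y.2 = triangleFrame t o y.1 then ⟨y.1 + 1, if o (y.1 + 1) then 1 else 0⟩
  else ⟨y.1 + 2, if o (y.1 + 2) then 0 else 1⟩

/-- A triangle tangle with crossings of the types `c`. -/
def triangle (t : Bool) (o : Fin 3 → Bool) (c : Fin 3 → CrossingType) : Tangle 3 where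
  len _ := 1
  Crossing := Fin 3
  strand := ⟨triangleStrand t o, by revert t o; decide⟩
  kind := c

/-- The types of the crossings of a triangle of classical crossings whose strand `l` runs at the
level `h l`. -/
def levelTypes (t : Bool) (o : Fin 3 → Bool) (h : Equiv.Perm (Fin 3)) (i : Fin 3) :
    CrossingType :=
  if decide (h (i + 2) < h (i + 1)) = triangleFrame t o i then .positive else .negative

/-- The local moves, for all orientations of the strands. -/
inductive LocalMove : {k : ℕ} → Tangle k → Tangle k → Prop
  /-- No change, up to an isomorphism of diagrams. -/
  | refl {k : ℕ} (T : Tangle k) : LocalMove T T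
  /-- Subdivision of an edge. -/
  | subdivision : LocalMove (plainTangle 1 0) (plainTangle 1 1)
  /-- The moves `R₁` (`c` classical) and `VR₁` (`c` virtual). -/
  | first (c : CrossingType) (b : Bool) : LocalMove (plainTangle 1 0) (kink c b)
  /-- The moves `R₂` (`c` classical) and `VR₂` (`c` virtual). -/
  | second (c : CrossingType) (b parallel : Bool) :
      LocalMove (plainTangle 2 0) (bigon c b parallel)
  /-- The move `R₃`: each strand passes its crossings with the other two in the opposite order. -/
  | third (t : Bool) (o : Fin 3 → Bool) (h : Equiv.Perm (Fin 3)) :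
      LocalMove (triangle t o (levelTypes t o h))
        (triangle t (fun l => !o l) (levelTypes t o h))
  /-- The moves `SVR₃` (one crossing `i` of classical type `c`, the other two virtual) and `VR₃`
  (`c` virtual as well). -/
  | thirdVirtual (t : Bool) (o : Fin 3 → Bool) (i : Fin 3) (c : CrossingType) :
      LocalMove (triangle t o (Function.update (fun _ => .virtual) i c))
        (triangle t (fun l => !o l) (Function.update (fun _ => .virtual) i c))

/-- An oriented virtual link diagram, with components numbered by `I`. -/
abbrev VirtualDiagram (I : Type) : Type 1 := {D : Diagram I // D.IsPlane}

/-- The diagrams `D` and `D'` are the two sides of a move. -/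
def Move {I : Type} (D D' : VirtualDiagram I) : Prop :=
  ∃ (k : ℕ) (C : Context k I) (T T' : Tangle k),
    LocalMove T T' ∧ Nonempty (Filling C T D.1) ∧ Nonempty (Filling C T' D'.1)

/-- Two diagrams represent the same oriented virtual link with numbered components: they are
connected by a finite sequence of moves and inverse moves through virtual link diagrams. -/
def SameLink {I : Type} : VirtualDiagram I → VirtualDiagram I → Prop := Relation.EqvGen Move

end VirtualLink

/-! Everything is a signed count of crossings in which the passage labelled `true` weighs +1 and the
one labelled `false` weighs -1. The wriggle number is this count over the classical crossings
(`wriggle_eq_totalCount`), and the value of the index class is the same count over the virtual ones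
(`eval_indexClass_eq_totalCount`). Their sum runs over all crossings and splits into the
intersection numbers of `D_i` with each `D_j`. These vanish in a plane diagram
(`IsPlane.signedCount_eq_zero`): there the cycle `D_i` bounds, that is, it is the jump across edges
of a function on the faces, and the changes of this function along the closed curve `D_j` add up to
zero.

The pairwise wriggle number is the classical count restricted to crossings of `D_i` with `D_j`
(`pairWriggle_eq`). Antisymmetry and the summation formula are then formal, and invariance reduces
to the crossings inside the tangles of each local move (`LocalMove.classicalCount_eq`). -/

namespace VirtualLink

/-! ### Signed counts of crossings between coloured strands. -/

open Classical in
/-- The signed number of crossings, of the types satisfying `p`, of a strand coloured `i` with a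
strand coloured `j`, in a finite family of crossings with coloured strands. -/
noncomputable def signedCount {X I : Type} [Fintype X] (p : X → Prop) (col : X → Bool → I)
    (i j : I) : ℤ :=
  ∑ x with p x, ((if col x true = i ∧ col x false = j then 1 else 0)
    - (if col x false = i ∧ col x true = j then 1 else 0))

open Classical in
/-- The signed number of crossings, of the types satisfying `p`, of a strand coloured `i` with
other strands, in a finite family of crossings with coloured strands. -/
noncomputable def totalCount {X I : Type} [Fintype X] (p : X → Prop) (col : X → Bool → I)
    (i : I) : ℤ :=
  ∑ x with p x, ((if col x true = i then 1 else 0) - (if col x false = i then 1 else 0))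

theorem signedCount_swap {X I : Type} [Fintype X] (p : X → Prop) (col : X → Bool → I) (i j : I) :
    signedCount p col j i = -signedCount p col i j := by
  classical
  unfold signedCount
  rw [← Finset.sum_neg_distrib]
  refine Finset.sum_congr rfl fun x _ => ?_
  simp only [and_comm, neg_sub]

/-- The other strand at a crossing has exactly one colour, so summing over `j` removes the condition
on it. -/
theorem sum_signedCount {X I : Type} [Fintype X] [Fintype I] (p : X → Prop)
    (col : X → Bool → I) (i : I) :
    ∑ j, signedCount p col i j = totalCount p col i := by
  classical
  unfold signedCount totalCount
  rw [Finset.sum_comm]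
  refine Finset.sum_congr rfl fun x _ => ?_
  simp [Finset.sum_sub_distrib, ite_and]

theorem signedCount_sum {X Y I : Type} [Fintype X] [Fintype Y] (p : X ⊕ Y → Prop)
    (col : X ⊕ Y → Bool → I) (i j : I) :
    signedCount p col i j = signedCount (fun x => p (.inl x)) (fun x => col (.inl x)) i j
      + signedCount (fun y => p (.inr y)) (fun y => col (.inr y)) i j := by
  classical
  simp only [signedCount, Finset.sum_filter, Fintype.sum_sum_type]

theorem signedCount_equiv {X Y I : Type} [Fintype X] [Fintype Y] (e : X ≃ Y) (p : Y → Prop)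
    (col : Y → Bool → I) (i j : I) :
    signedCount (fun x => p (e x)) (fun x => col (e x)) i j = signedCount p col i j := by
  classical
  simp only [signedCount, Finset.sum_filter]
  exact e.sum_comp (fun y => if p y then
    ((if col y true = i ∧ col y false = j then 1 else 0)
    - (if col y false = i ∧ col y true = j then 1 else 0) : ℤ) else 0)

/-! ### Linear algebra over ℚ. -/

/-- If a family of functions factors through a finite set, its dimension is at most the size of
this set. -/
theorem finrank_le_card_of_factor {X Y : Type} [Finite X] [Finite Y] (S : Submodule ℚ (X → ℚ))
    (π : X → Y) (h : ∀ f ∈ S, ∃ p : Y → ℚ, p ∘ π = f) : Module.finrank ℚ S ≤ Nat.card Y := by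
  have := Fintype.ofFinite Y
  have hS : S ≤ LinearMap.range (LinearMap.funLeft ℚ ℚ π) := fun f hf => by
    obtain ⟨p, rfl⟩ := h f hf
    exact ⟨p, rfl⟩
  calc Module.finrank ℚ S ≤ Module.finrank ℚ (LinearMap.range (LinearMap.funLeft ℚ ℚ π)) :=
        Submodule.finrank_mono hS
    _ ≤ Module.finrank ℚ (Y → ℚ) := LinearMap.finrank_range_le _
    _ = Nat.card Y := by rw [Module.finrank_fintype_fun_eq_card, Nat.card_eq_fintype_card]

/-- Two orthogonal subspaces of complementary dimensions are the orthogonal complements of each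
other. -/
theorem mem_of_orthogonal {X : Type} [Fintype X] (A B : Submodule ℚ (X → ℚ))
    (hAB : ∀ a ∈ A, ∀ b ∈ B, ∑ x, a x * b x = 0)
    (hdim : Fintype.card X ≤ Module.finrank ℚ A + Module.finrank ℚ B)
    (z : X → ℚ) (hz : ∀ b ∈ B, ∑ x, z x * b x = 0) : z ∈ A := by
  -- The standard form is positive definite over ℚ, so `A` and `B` meet trivially and the dimension
  -- bound makes them span.
  have key : ∀ b : X → ℚ, ∑ x, b x * b x = 0 → b = 0 := fun b hb => by
    funext x
    rw [Finset.sum_eq_zero_iff_of_nonneg fun x _ => mul_self_nonneg (b x)] at hb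
    exact mul_self_eq_zero.1 (hb x (Finset.mem_univ x))
  have hinf : A ⊓ B = ⊥ := by
    rw [eq_bot_iff]
    rintro b ⟨ha, hb⟩
    exact key b (hAB b ha b hb)
  have hsup : A ⊔ B = ⊤ := by
    apply Submodule.eq_top_of_finrank_eq
    have h := Submodule.finrank_sup_add_finrank_inf_eq A B
    rw [hinf, finrank_bot, add_zero] at h
    refine le_antisymm (Submodule.finrank_le _) ?_
    rw [Module.finrank_fintype_fun_eq_card, h]
    exact hdim
  obtain ⟨a, ha, b, hb, rfl⟩ := Submodule.mem_sup.1 (hsup ▸ Submodule.mem_top : z ∈ A ⊔ B)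
  have hb0 : b = 0 := key b <| by
    have h1 := hz b hb
    simpa [add_mul, Finset.sum_add_distrib, hAB a ha b hb] using h1
  simpa [hb0] using ha

/-! ### Faces, edges and vertices of the ribbon graph as a chain complex. -/

namespace Diagram

variable {I : Type} (D : Diagram I)

instance : Finite D.Face := inferInstanceAs (Finite (Quot D.Corner))

instance : Finite D.Piece := inferInstanceAs (Finite (Quot D.Linked))

/-- The vertices of the 4-valent graph: the crossings and the subdivision points. -/
abbrev GraphVertex : Type := D.Crossing ⊕ {a : D.Passage // a ∉ Set.range D.strand}

open Classical in
/-- The crossing or subdivision point through which a passage runs. -/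
noncomputable def vertexOf (a : D.Passage) : D.GraphVertex :=
  if h : a ∈ Set.range D.strand then .inl h.choose.1 else .inr ⟨a, h⟩

theorem vertexOf_strand (y : D.Crossing × Bool) : D.vertexOf (D.strand y) = .inl y.1 := by
  have h : D.strand y ∈ Set.range D.strand := ⟨y, rfl⟩
  rw [vertexOf, dif_pos h, D.strand.injective h.choose_spec]

theorem vertexOf_point {a : D.Passage} (ha : a ∉ Set.range D.strand) :
    D.vertexOf a = .inr ⟨a, ha⟩ := dif_neg ha

/-- The face on a side of the edge leaving a passage. -/
def face (a : D.Passage) (side : Bool) : D.Face := Quot.mk _ (a, side)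

/-- The connected piece containing a passage. -/
def piece (a : D.Passage) : D.Piece := Quot.mk _ a

theorem piece_next (a : D.Passage) : D.piece (D.next a) = D.piece a :=
  (Quot.sound (Linked.along a)).symm

theorem piece_next_symm (a : D.Passage) : D.piece (D.next.symm a) = D.piece a := by
  rw [← D.piece_next, Equiv.apply_symm_apply]

theorem piece_strand (x : D.Crossing) :
    D.piece (D.strand (x, true)) = D.piece (D.strand (x, false)) := Quot.sound (Linked.across x)

/-- The piece to which a face is adjacent. -/
def facePiece : D.Face → D.Piece :=
  Quot.lift (fun e => D.piece e.1) (by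
    rintro _ _ (x | x | x | x | ⟨a, ha, side⟩) <;>
      simp [piece_next_symm, piece_strand])

/-- The piece to which a vertex belongs. -/
def vertexPiece : D.GraphVertex → D.Piece
  | .inl x => D.piece (D.strand (x, true))
  | .inr a => D.piece a.1

/-- A sum over all passages of a function vanishing at the subdivision points. -/
theorem sum_passage {M : Type} [AddCommMonoid M] (φ : D.Passage → M)
    (h : ∀ a ∉ Set.range D.strand, φ a = 0) :
    ∑ a, φ a = ∑ x, (φ (D.strand (x, true)) + φ (D.strand (x, false))) := by
  classical
  rw [← Finset.sum_subset (Finset.subset_univ (Finset.univ.map D.strand)) fun a _ ha => h a ?_,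
    Finset.sum_map, Fintype.sum_prod_type]
  · simp
  · simpa using ha

/-- The jump of a function on the faces across the edges. -/
def jump : (D.Face → ℚ) →ₗ[ℚ] (D.Passage → ℚ) where
  toFun f a := f (D.face a true) - f (D.face a false)
  map_add' f g := by funext a; simp only [Pi.add_apply]; ring
  map_smul' c f := by funext a; simp [mul_sub]

/-- The increment of a function on the vertices along the edges. -/
noncomputable def increment : (D.GraphVertex → ℚ) →ₗ[ℚ] (D.Passage → ℚ) where
  toFun h a := h (D.vertexOf (D.next a)) - h (D.vertexOf a)
  map_add' f g := by funext a; simp only [Pi.add_apply]; ring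
  map_smul' c f := by funext a; simp [mul_sub]

theorem face_northEast (x : D.Crossing) :
    D.face (D.strand (x, true)) true = D.face (D.strand (x, false)) false :=
  Quot.sound (Corner.northEast x)

theorem face_northWest (x : D.Crossing) :
    D.face (D.next.symm (D.strand (x, true))) true = D.face (D.strand (x, false)) true :=
  Quot.sound (Corner.northWest x)

theorem face_southWest (x : D.Crossing) :
    D.face (D.next.symm (D.strand (x, true))) false
      = D.face (D.next.symm (D.strand (x, false))) true :=
  Quot.sound (Corner.southWest x)

theorem face_southEast (x : D.Crossing) :
    D.face (D.strand (x, true)) false = D.face (D.next.symm (D.strand (x, false))) false :=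
  Quot.sound (Corner.southEast x)

theorem face_point {a : D.Passage} (ha : a ∉ Set.range D.strand) (side : Bool) :
    D.face (D.next.symm a) side = D.face a side :=
  Quot.sound (Corner.point a ha side)

/-- Summation by parts along the components. -/
theorem sum_mul_increment (z : D.Passage → ℚ) (h : D.GraphVertex → ℚ) :
    ∑ a, z a * D.increment h a = ∑ a, (z (D.next.symm a) - z a) * h (D.vertexOf a) := by
  have e := Equiv.sum_comp D.next fun a => z (D.next.symm a) * h (D.vertexOf a)
  simp only [Equiv.symm_apply_apply] at e
  simp only [increment, LinearMap.coe_mk, AddHom.coe_mk, mul_sub, sub_mul,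
    Finset.sum_sub_distrib, e]

/-- The boundary of a boundary is zero: around a crossing each of the four corner faces occurs once
with each sign. -/
theorem jump_orthogonal_increment (f : D.Face → ℚ) (h : D.GraphVertex → ℚ) :
    ∑ a, D.jump f a * D.increment h a = 0 := by
  rw [sum_mul_increment, sum_passage]
  · refine Finset.sum_eq_zero fun x _ => ?_
    simp only [jump, LinearMap.coe_mk, AddHom.coe_mk, vertexOf_strand, face_northEast,
      face_northWest, face_southWest, face_southEast]
    ring
  · intro a ha
    simp [jump, D.face_point ha]

/-- A function without jumps agrees on both sides of every edge and on all corners at a vertex,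
hence depends only on the piece. -/
theorem finrank_ker_jump_le : Module.finrank ℚ (LinearMap.ker D.jump) ≤ Nat.card D.Piece := by
  refine finrank_le_card_of_factor _ D.facePiece fun f hf => ?_
  have hf' : ∀ a, f (D.face a true) = f (D.face a false) := fun a =>
    sub_eq_zero.1 (congrFun hf a)
  refine ⟨Quot.lift (fun a => f (D.face a true)) ?_, ?_⟩
  · rintro _ _ (_ | x)
    · rename_i a
      -- The edge is renamed by the passage `b` at which it arrives, since the corner relations are
      -- stated at the vertex.
      obtain ⟨b, rfl⟩ := D.next.symm.surjective a
      rw [Equiv.apply_symm_apply]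
      by_cases hb : b ∈ Set.range D.strand
      · obtain ⟨⟨x, s⟩, rfl⟩ := hb
        have h1 := hf' (D.strand (x, true))
        have h2 := hf' (D.strand (x, false))
        have h3 := hf' (D.next.symm (D.strand (x, true)))
        have h4 := hf' (D.next.symm (D.strand (x, false)))
        simp only [face_northEast, face_northWest, face_southWest, face_southEast] at h1 h2 h3 h4
        cases s
        · exact h3.symm
        · simp only [face_northEast, face_northWest]
          exact h2
      · exact congrArg f (D.face_point hb true)
    · exact (congrArg f (D.face_northEast x)).trans (hf' _).symm
  · funext e
    obtain ⟨⟨a, s⟩, rfl⟩ := Quot.exists_rep e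
    cases s
    · exact hf' a
    · rfl

theorem finrank_ker_increment_le :
    Module.finrank ℚ (LinearMap.ker D.increment) ≤ Nat.card D.Piece := by
  refine finrank_le_card_of_factor _ D.vertexPiece fun h hh => ?_
  refine ⟨Quot.lift (fun a => h (D.vertexOf a)) ?_, ?_⟩
  · rintro _ _ (_ | _)
    · exact (sub_eq_zero.1 (congrFun hh _)).symm
    · simp only [vertexOf_strand]
  · funext v
    obtain x | ⟨a, ha⟩ := v
    · exact congrArg h (D.vertexOf_strand (x, true))
    · exact congrArg h (D.vertexOf_point ha)

/-! ### Vanishing of intersection numbers in plane diagrams. -/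

variable {D}

/-- In a plane diagram, every function on the edges that is constant along the components is
the jump of a function on the faces. -/
theorem IsPlane.exists_jump_eq (hD : D.IsPlane) (z : D.Passage → ℚ)
    (hz : ∀ a, z (D.next a) = z a) : ∃ f, D.jump f = z := by
  have := Fintype.ofFinite D.Face
  have := Fintype.ofFinite {a : D.Passage // a ∉ Set.range D.strand}
  refine mem_of_orthogonal (LinearMap.range D.jump) (LinearMap.range D.increment) ?_ ?_ z ?_
  · rintro _ ⟨f, rfl⟩ _ ⟨h, rfl⟩
    exact D.jump_orthogonal_increment f h
  · have h1 := LinearMap.finrank_range_add_finrank_ker D.jump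
    have h2 := LinearMap.finrank_range_add_finrank_ker D.increment
    have h3 := D.finrank_ker_jump_le
    have h4 := D.finrank_ker_increment_le
    rw [Module.finrank_fintype_fun_eq_card] at h1 h2
    rw [Fintype.card_sum] at h2
    unfold IsPlane at hD
    simp only [Nat.card_eq_fintype_card (α := D.Face), Nat.card_eq_fintype_card (α := D.Passage),
      Nat.card_eq_fintype_card (α := D.Crossing),
      Nat.card_eq_fintype_card (α := {a : D.Passage // a ∉ Set.range D.strand})] at hD
    -- The two ranks add up to at least `(F - P) + (V - P)`, where `P` is the number of pieces; by
    -- genus zero this is the number of edges.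
    omega
  · rintro _ ⟨h, rfl⟩
    rw [sum_mul_increment]
    refine Finset.sum_eq_zero fun a _ => ?_
    rw [← hz (D.next.symm a), Equiv.apply_symm_apply, sub_self, zero_mul]

/-- The colouring of the passages through the crossings by the components. -/
def colour (D : Diagram I) (x : D.Crossing) (s : Bool) : I := D.comp (D.strand (x, s))

/-- In a plane diagram, the intersection number of two components vanishes. -/
theorem IsPlane.signedCount_eq_zero (hD : D.IsPlane) (i j : I) :
    signedCount (fun _ => True) D.colour i j = 0 := by
  classical
  let u : I → I → ℚ := fun a b => if a = b then 1 else 0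
  -- `f` plays the role of the winding number around `D_i`: it rises by 1 from the right to the left
  -- of `D_i`.
  obtain ⟨f, hf⟩ := hD.exists_jump_eq (fun a => u (D.comp a) i) fun a => by rw [D.comp_next]
  have hf' : ∀ a, f (D.face a true) - f (D.face a false) = u (D.comp a) i :=
    fun a => congrFun hf a
  -- On the edges of `D_j`, twice the mean of `f` over the two sides; zero on the other edges.
  let g : D.Passage → ℚ := fun a => u (D.comp a) j * (f (D.face a true) + f (D.face a false))
  have h0 : ∑ a, (g a - g (D.next.symm a)) = 0 := by
    rw [Finset.sum_sub_distrib, Equiv.sum_comp D.next.symm g, sub_self]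
  rw [D.sum_passage _ fun a ha => by simp [g, D.comp_next_symm, D.face_point ha]] at h0
  have hand : ∀ (a b c d : I) [Decidable (a = b ∧ c = d)],
      ((if a = b ∧ c = d then 1 else 0 : ℤ) : ℚ) = u a b * u c d := fun a b c d _ => by
    by_cases hab : a = b <;> by_cases hcd : c = d <;> simp [u, hab, hcd]
  -- A passage of `D_j` changes `g` by ±2 exactly when the other passage belongs to `D_i`, because
  -- both sides of `D_j` step over `D_i`; the sign is the label of the frame.
  have h1 : ∀ x, (g (D.strand (x, true)) - g (D.next.symm (D.strand (x, true))))
      + (g (D.strand (x, false)) - g (D.next.symm (D.strand (x, false))))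
      = 2 * (((if D.colour x true = i ∧ D.colour x false = j then 1 else 0)
        - (if D.colour x false = i ∧ D.colour x true = j then 1 else 0) : ℤ) : ℚ) := by
    intro x
    have e1 := hf' (D.strand (x, true))
    have e2 := hf' (D.strand (x, false))
    have e3 := hf' (D.next.symm (D.strand (x, true)))
    have e4 := hf' (D.next.symm (D.strand (x, false)))
    rw [Int.cast_sub, hand, hand]
    simp only [g, colour, D.comp_next_symm] at e1 e2 e3 e4 ⊢
    simp only [face_northEast, face_northWest, face_southWest, face_southEast] at e1 e2 e3 e4 ⊢
    linear_combination u (D.comp (D.strand (x, false))) j * (e1 + e3)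
      - u (D.comp (D.strand (x, true))) j * (e2 + e4)
  rw [Finset.sum_congr rfl fun x _ => h1 x, ← Finset.mul_sum, ← Int.cast_sum] at h0
  unfold signedCount
  rw [Finset.filter_true]
  exact Int.cast_eq_zero.1 ((mul_eq_zero.1 h0).resolve_left two_ne_zero)

/-! ### Wriggle numbers and index classes as signed counts. -/

variable (D)

/-- At a negative crossing both the sign and the label of the overpass switch, so the `true` passage
weighs +1 in either case. -/
theorem wriggle_eq_totalCount (i : I) :
    D.wriggle i = totalCount D.IsClassical D.colour i := by
  classical
  simp only [totalCount, wriggle, overLinking, underLinking, Finset.sum_filter,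
    ← Finset.sum_sub_distrib]
  refine Finset.sum_congr rfl fun x _ => ?_
  unfold overPass underPass IsClassical colour
  cases D.kind x <;> simp [CrossingType.sign]
  split_ifs <;> rfl

/-- Each virtual passage lies on exactly one long arc, and this arc has the component of the
passage; exchanging the sums over arcs and crossings leaves the weights ±1. -/
theorem eval_indexClass_eq_totalCount (i : I) :
    D.eval (D.componentCycle i) D.indexClass
      = totalCount (fun x => ¬ D.IsClassical x) D.colour i := by
  classical
  have h : D.eval (D.componentCycle i) D.indexClass
      = ∑ e, (if D.arcComp e = i then 1 else 0) * D.virtualIndex e := by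
    refine (LinearMap.sum_apply _ _ _).trans (Finset.sum_congr rfl fun e _ => ?_)
    rw [LinearMap.smul_apply]
    rfl
  rw [h]
  simp only [virtualIndex, totalCount, Finset.mul_sum]
  rw [Finset.sum_comm]
  simp only [IsClassical, not_not]
  refine Finset.sum_congr rfl fun x _ => ?_
  simp only [mul_sub, Finset.sum_sub_distrib, mul_ite, mul_one, mul_zero, Finset.sum_ite_eq,
    Finset.mem_univ, if_true]
  rfl

theorem wriggle_add_eval (i : I) :
    D.wriggle i + D.eval (D.componentCycle i) D.indexClass
      = totalCount (fun _ => True) D.colour i := by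
  classical
  rw [wriggle_eq_totalCount, eval_indexClass_eq_totalCount]
  unfold totalCount
  rw [Finset.sum_filter_add_sum_filter_not, Finset.filter_true]

/-- Self-crossings of `D_i` contribute 1 - 1 and crossings avoiding `D_i` nothing, so only the mixed
crossings remain. The predicate `p` is left free to serve for the classical crossings as well as for
all of them. -/
theorem totalCount_pair (i j : I) (p : D.Crossing → Prop) :
    totalCount (fun x : (D.pair i j).Crossing => p x.1) (D.pair i j).colour (inPair i j)
      = signedCount p D.colour i j := by
  classical
  have h : ∀ (x : (D.pair i j).Crossing) s,
      (D.pair i j).colour x s = inPair i j ↔ D.colour x.1 s = i := fun x s => Subtype.ext_iff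
  unfold totalCount signedCount
  simp only [h]
  rw [Finset.sum_filter, Finset.sum_filter]
  let F : D.Crossing → ℤ := fun x => if p x then
    (if D.colour x true = i then 1 else 0) - (if D.colour x false = i then 1 else 0) else 0
  have h1 : ∑ x : (D.pair i j).Crossing, F x.1
      = ∑ x with ∀ s, D.colour x s ∈ ({i, j} : Set I), F x := by
    symm
    apply Finset.sum_subtype
    intro x
    simp [colour]
  refine h1.trans ?_
  rw [Finset.sum_filter]
  refine Finset.sum_congr rfl fun x _ => ?_
  simp only [F, Bool.forall_bool, Set.mem_insert_iff, Set.mem_singleton_iff]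
  by_cases hp : p x <;> by_cases h1 : D.colour x true = i <;>
    by_cases h2 : D.colour x false = i <;> by_cases h3 : D.colour x true = j <;>
    by_cases h4 : D.colour x false = j <;> simp_all

theorem pairWriggle_eq (i j : I) :
    D.pairWriggle i j = signedCount D.IsClassical D.colour i j := by
  rw [pairWriggle, wriggle_eq_totalCount, ← totalCount_pair]
  rfl

variable {D}

theorem IsPlane.wriggle_eq_neg_eval [Fintype I] (hD : D.IsPlane) (i : I) :
    D.wriggle i = -D.eval (D.componentCycle i) D.indexClass := by
  rw [← add_eq_zero_iff_eq_neg, wriggle_add_eval, ← sum_signedCount]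
  exact Finset.sum_eq_zero fun j _ => hD.signedCount_eq_zero i j

/-- The full count in the subdiagram is an intersection number in `D` itself, so planarity is needed
only for `D`. -/
theorem IsPlane.pairWriggle_eq_neg_eval (hD : D.IsPlane) (i j : I) :
    D.pairWriggle i j =
      -(D.pair i j).eval ((D.pair i j).componentCycle (inPair i j)) (D.pair i j).indexClass := by
  rw [← add_eq_zero_iff_eq_neg, pairWriggle, wriggle_add_eval]
  exact (D.totalCount_pair i j fun _ => True).trans (hD.signedCount_eq_zero i j)

end Diagram

/-! ### Invariance -/

/-- The signed number of classical crossings of strands coloured `i` and `j` in a tangle. -/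
noncomputable def Tangle.classicalCount {k : ℕ} {I : Type} (T : Tangle k) [Fintype T.Crossing]
    (col : Fin k → I) (i j : I) : ℤ :=
  signedCount (fun x => T.kind x ≠ .virtual) (fun x s => col (T.strand (x, s)).1) i j

/-- The share of the context is common to both sides of a move, which leaves a comparison of
tangles. -/
theorem Filling.signedCount_eq {k : ℕ} {I : Type} {C : Context k I} {T : Tangle k} {D : Diagram I}
    (φ : Filling C T D) [Fintype C.Crossing] [Fintype T.Crossing] (i j : I) :
    signedCount D.IsClassical D.colour i j
      = signedCount (fun x => C.kind x ≠ .virtual) (fun x s => C.comp (.inl (C.strand (x, s)))) i j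
        + T.classicalCount (fun l => C.comp (.inr l)) i j := by
  rw [← signedCount_equiv φ.crossing, signedCount_sum]
  unfold Tangle.classicalCount
  congr 1 <;> congr 1
  · funext x
    rw [Diagram.IsClassical, φ.kind_outer]
  · funext x s
    rw [Diagram.colour, φ.strand_outer, φ.comp_outer]
  · funext x
    rw [Diagram.IsClassical, φ.kind_inner]
  · funext x s
    rw [Diagram.colour, φ.strand_inner]
    exact φ.comp_inner _ _

/-- A frame depends only on whether two strands have equal values of `o`; negating all of `o`
preserves this and changes only the order of passages along the strands. -/
theorem triangleStrand_not_fst (t : Bool) (o : Fin 3 → Bool) (y : Fin 3 × Bool) :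
    (triangleStrand t (fun l => !o l) y).1 = (triangleStrand t o y).1 := by
  revert t o y
  decide

theorem signedCount_empty {X I : Type} [Fintype X] [IsEmpty X] (p : X → Prop)
    (col : X → Bool → I) (i j : I) : signedCount p col i j = 0 := by
  simp [signedCount]

/-- The form of the bigon: two crossings of the same strands with exchanged labels cancel. -/
theorem signedCount_bool {I : Type} (p : Bool → Prop) (col : Bool → Bool → I)
    (hp : p true ↔ p false) (hcol : ∀ s, col true s = col false (!s)) (i j : I) :
    signedCount p col i j = 0 := by
  classical
  unfold signedCount
  rw [Finset.sum_filter, Fintype.sum_bool]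
  by_cases h : p false <;> simp [hp, hcol, h]

theorem bigonStrand_swap (b parallel s : Bool) :
    (bigonStrand b parallel (true, s)).1 = (bigonStrand b parallel (false, !s)).1 := by
  revert b parallel s
  decide

theorem LocalMove.classicalCount_eq {k : ℕ} {I : Type} {T T' : Tangle k} (h : LocalMove T T')
    [hT : Fintype T.Crossing] [hT' : Fintype T'.Crossing] (col : Fin k → I) (i j : I) :
    T.classicalCount col i j = T'.classicalCount col i j := by
  classical
  have hempty : ∀ (k m : ℕ) [Fintype (plainTangle k m).Crossing] (col : Fin k → I),
      (plainTangle k m).classicalCount col i j = 0 := fun k m _ col =>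
    have : IsEmpty (plainTangle k m).Crossing := inferInstanceAs (IsEmpty Empty)
    signedCount_empty _ _ i j
  revert hT hT'
  induction h with
  | refl T =>
    intro hT hT'
    rw [Subsingleton.elim hT hT']
  | subdivision =>
    intro hT hT'
    rw [hempty, hempty]
  | first c b =>
    intro hT hT'
    rw [hempty]
    symm
    refine Finset.sum_eq_zero fun x _ => ?_
    -- Both passages of a kink have the same colour, so its two indicators coincide.
    have e : ∀ s, ((kink c b).strand (x, s)).1 = 0 := fun s => rfl
    simp [e]
  | second c b parallel =>
    intro hT hT'
    rw [hempty]
    obtain rfl : hT' = inferInstanceAs (Fintype Bool) := Subsingleton.elim _ _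
    refine (signedCount_bool _ _ ?_ (fun s => ?_) i j).symm
    -- The crossings of a bigon are both classical or both virtual.
    · refine not_congr ?_
      change c.opposite = .virtual ↔ c = .virtual
      cases c <;> simp [CrossingType.opposite]
    · exact congrArg col (bigonStrand_swap b parallel s)
  | third t o h =>
    intro hT hT'
    rw [Subsingleton.elim hT hT']
    unfold Tangle.classicalCount
    congr 1
    funext x s
    exact congrArg col (triangleStrand_not_fst t o (x, s)).symm
  | thirdVirtual t o l c =>
    intro hT hT'
    rw [Subsingleton.elim hT hT']
    unfold Tangle.classicalCount
    congr 1
    funext x s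
    exact congrArg col (triangleStrand_not_fst t o (x, s)).symm

theorem Move.pairWriggle_eq {I : Type} {D D' : VirtualDiagram I} (h : Move D D') (i j : I) :
    D.1.pairWriggle i j = D'.1.pairWriggle i j := by
  obtain ⟨k, C, T, T', hTT', ⟨φ⟩, ⟨ψ⟩⟩ := h
  -- Contexts and tangles carry no finiteness of their own; it is inherited from the filled
  -- diagrams.
  have : Finite (C.Crossing ⊕ T.Crossing) := Finite.of_equiv _ φ.crossing.symm
  have : Finite (C.Crossing ⊕ T'.Crossing) := Finite.of_equiv _ ψ.crossing.symm
  have : Fintype C.Crossing := @Fintype.ofFinite _ (Finite.sum_left T.Crossing)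
  have : Fintype T.Crossing := @Fintype.ofFinite _ (Finite.sum_right C.Crossing)
  have : Fintype T'.Crossing := @Fintype.ofFinite _ (Finite.sum_right C.Crossing)
  rw [Diagram.pairWriggle_eq, Diagram.pairWriggle_eq, φ.signedCount_eq, ψ.signedCount_eq,
    hTT'.classicalCount_eq]

theorem SameLink.pairWriggle_eq {I : Type} {D D' : VirtualDiagram I} (h : SameLink D D')
    (i j : I) : D.1.pairWriggle i j = D'.1.pairWriggle i j := by
  induction h with
  | rel _ _ h => exact h.pairWriggle_eq i j
  | refl _ => rfl
  | symm _ _ _ ih => exact ih.symm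
  | trans _ _ _ _ _ ih ih' => exact ih.trans ih'

end VirtualLink

theorem mainTheorem8 (n : ℕ) :
    -- the wriggle number of a component is minus the value of the index class on it
    (∀ (D : VirtualLink.VirtualDiagram (Fin n)) (i : Fin n),
      D.1.wriggle i = -D.1.eval (D.1.componentCycle i) D.1.indexClass) ∧
    -- the same for a pair of components
    (∀ (D : VirtualLink.VirtualDiagram (Fin n)) (i j : Fin n),
      D.1.pairWriggle i j =
        -(D.1.pair i j).eval ((D.1.pair i j).componentCycle (VirtualLink.Diagram.inPair i j))
          (D.1.pair i j).indexClass) ∧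
    -- invariance
    (∀ (D D' : VirtualLink.VirtualDiagram (Fin n)), VirtualLink.SameLink D D' →
      ∀ i j : Fin n, D.1.pairWriggle i j = D'.1.pairWriggle i j) ∧
    -- antisymmetry
    (∀ (D : VirtualLink.VirtualDiagram (Fin n)) (i j : Fin n),
      D.1.pairWriggle j i = -D.1.pairWriggle i j) ∧
    -- summation
    (∀ (D : VirtualLink.VirtualDiagram (Fin n)) (i : Fin n),
      D.1.wriggle i = ∑ j : Fin n, D.1.pairWriggle i j) := by
  refine ⟨fun D i => D.2.wriggle_eq_neg_eval i, fun D i j => D.2.pairWriggle_eq_neg_eval i j,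
    fun D D' h i j => h.pairWriggle_eq i j, fun D i j => ?_, fun D i => ?_⟩
  · rw [VirtualLink.Diagram.pairWriggle_eq, VirtualLink.Diagram.pairWriggle_eq,
      VirtualLink.signedCount_swap]
  · simp only [VirtualLink.Diagram.pairWriggle_eq]
    rw [VirtualLink.Diagram.wriggle_eq_totalCount, VirtualLink.sum_signedCount]
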